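/- Let $\mathsf k$ be a field, let $S=\mathsf k[x_1,\dots,x_n]$, let $q\ge 1$ and $r\ge 2$ be integers, and let $I\subseteq S$ be an ideal minimally generated by $q$ square-free monomials. A free resolution of an $S$-module $M$ is an exact sequence $0\to S^{\beta_L}\to\cdots\to S^{\beta_1}\to S^{\beta_0}\to M\to 0$, and the $t$-th Betti number $\beta_t(M)$ is the smallest possible rank of the free module in the $t$-th spot of a free resolution of $M$. Let $b$ be the coefficient of $x^r$ in the expansion of $$(1+x+x^2+\cdots+x^{\lceil r/2\rceil})^q,$$ and let $$f=\frac{\binom{q+r-1}{r}-b-q}{q}+b .$$ Then $I^r$ has a free resolution, $f$ is a non-negative integer, and for every $t\ge 0$ $$\beta_t(I^r)\le q\left(\binom{q-1}{t}+\binom{f}{t+1}-\binom{b}{t+1}\right)+\binom{b}{t+1}.$$ In particular, $\operatorname{pd}_S(I^r)\le\max\{q-1,\,f-1\}$. -/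

import Mathlib

open MvPolynomial

/-- A (finite) free resolution of an `S`-module `M`: an exact sequence
`0 → S^{β_L} → ⋯ → S^{β_1} → S^{β_0} → M → 0` with `β_j = rank j`
(and `rank j = 0` for `j > L`). -/
structure FreeResolution (S : Type*) [CommRing S] (M : Type*) [AddCommGroup M] [Module S M] where
  /-- the ranks of the free modules -/
  rank : ℕ → ℕ
  /-- the differentials -/
  d : ∀ j : ℕ, (Fin (rank (j + 1)) → S) →ₗ[S] (Fin (rank j) → S)
  /-- the augmentation -/
  aug : (Fin (rank 0) → S) →ₗ[S] M
  aug_surjective : Function.Surjective aug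
  exact_zero : Function.Exact (d 0) aug
  exact_succ : ∀ j : ℕ, Function.Exact (d (j + 1)) (d j)
  finite_length : ∃ L : ℕ, ∀ j : ℕ, L < j → rank j = 0

/-- The `t`-th Betti number of `M`: the smallest possible rank of the free module in the `t`-th
spot of a free resolution of `M`. (Meaningful when `M` has a free resolution.) -/
noncomputable def bettiNumber (S : Type*) [CommRing S] (M : Type*) [AddCommGroup M] [Module S M]
    (t : ℕ) : ℕ :=
  sInf {n : ℕ | ∃ F : FreeResolution S M, F.rank t = n}

/-- A square-free monomial: a product of distinct variables. -/
def IsSquarefreeMonomial {K : Type*} [Field K] {n : ℕ} (p : MvPolynomial (Fin n) K) : Prop :=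
  ∃ A : Finset (Fin n), p = ∏ x ∈ A, X x

/-- `I` is minimally generated by `m_1, …, m_q`: these elements generate `I`, and none of them is
in the ideal generated by the others. -/
def IsMinimallyGeneratedBy {S : Type*} [CommRing S] {q : ℕ} (I : Ideal S) (m : Fin q → S) : Prop :=
  Ideal.span (Set.range m) = I ∧ ∀ i : Fin q, m i ∉ Ideal.span (m '' {i}ᶜ)

/-- The coefficient of `x ^ r` in `(1 + x + x ^ 2 + ⋯ + x ^ ⌈r / 2⌉) ^ q`. -/
noncomputable def baseCoeff (q r : ℕ) : ℕ :=
  ((∑ i ∈ Finset.range (⌈(r : ℚ) / 2⌉₊ + 1), (Polynomial.X : Polynomial ℕ) ^ i) ^ q).coeff r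

/-! Index the products of `r` of the `q` generators by vectors `a` of sum `r`, and label each vector
with the exponent of its product. By the Bayer–Peeva–Sturmfels criterion (`exists_freeResolution`),
a simplicial complex on these vectors supports a free resolution of `I ^ r` once, for every monomial
`x ^ u`, the subcomplex of faces whose labels divide `x ^ u` is acyclic. The Betti numbers are then
at most the face numbers.

The complex `powerComplex` has two families of facets. The side simplices contain all balanced
vectors (entries at most `⌈r / 2⌉`) and the vectors dominated by one index `i`, except the pure
power `r · e_i`. The corner simplices join that pure power to its neighbours, the vectors with
`i`-th entry `r - 1`.

Acyclicity uses two exchanges valid for square-free generators. If a pure power and another product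
divide `x ^ u`, so does a neighbour of the pure power (`exists_corner_neighbour`). If products
dominated by two different indices divide `x ^ u`, so does a balanced one
(`exists_mem_baseVertices`). These make the union of side simplices a cone, and let the corner
simplices be glued on one at a time along cones (`acyclic_induced_powerComplex`).

There are `b` balanced vectors. If `d` vectors are dominated by each index, the total number is `b +
q * d`, and each side simplex has `f = b + d - 1` vertices. Counting faces gives the bound, and its
vanishing for large `t` bounds the projective dimension. -/

namespace SimplicialResolution

/-! ### Simplicial chains and acyclicity: cones and gluing -/

section Boundary

variable {V : Type*}

/-- The incidence sign of the vertex `v` with respect to the face `τ`, for the vertex order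
given by the numbering `o`. -/
def incidenceSign (o : V → ℕ) (v : V) (τ : Finset V) : ℤ :=
  (-1) ^ (τ.filter fun w => o w < o v).card

theorem incidenceSign_mul_self (o : V → ℕ) (v : V) (τ : Finset V) :
    incidenceSign o v τ * incidenceSign o v τ = 1 := by
  rw [incidenceSign, ← mul_pow]; simp

theorem incidenceSign_insert [DecidableEq V] (o : V → ℕ) {v : V} {τ : Finset V} (hv : v ∉ τ) (w : V) :
    incidenceSign o w (insert v τ) = (if o v < o w then -1 else 1) * incidenceSign o w τ := by
  unfold incidenceSign
  rw [Finset.filter_insert]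
  split_ifs with h
  · rw [Finset.card_insert_of_notMem (by simp [hv]), pow_succ]; ring
  · simp

/-- The sign rule behind `∂ ∂ = 0`: exactly one of the two insertions changes the other vertex's
sign. -/
theorem incidenceSign_swap [DecidableEq V] {o : V → ℕ} (ho : Function.Injective o) {v w : V} {τ : Finset V}
    (hv : v ∉ τ) (hw : w ∉ τ) (hvw : v ≠ w) :
    incidenceSign o v τ * incidenceSign o w (insert v τ) =
      -(incidenceSign o w τ * incidenceSign o v (insert w τ)) := by
  rw [incidenceSign_insert o hv, incidenceSign_insert o hw]
  rcases lt_or_gt_of_ne (fun h => hvw (ho h)) with h | h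
  · rw [if_pos h, if_neg h.not_gt]; ring
  · rw [if_pos h, if_neg h.not_gt]; ring

variable {A : Type*} [AddCommGroup A]

/-- The chain `g` is supported on the set of faces `Δ`. -/
def SupportedOn (Δ : Set (Finset V)) (g : Finset V → A) : Prop :=
  ∀ σ, g σ ≠ 0 → σ ∈ Δ

theorem SupportedOn.mono {Δ Δ' : Set (Finset V)} (h : Δ ⊆ Δ') {g : Finset V → A}
    (hg : SupportedOn Δ g) : SupportedOn Δ' g := fun σ hσ => h (hg σ hσ)

theorem SupportedOn.add {Δ : Set (Finset V)} {g h : Finset V → A}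
    (hg : SupportedOn Δ g) (hh : SupportedOn Δ h) : SupportedOn Δ (g + h) := by
  intro σ hσ
  by_contra hn
  exact hσ (by simp [not_not.1 (mt (hg σ) hn), not_not.1 (mt (hh σ) hn)])

theorem SupportedOn.sub {Δ : Set (Finset V)} {g h : Finset V → A}
    (hg : SupportedOn Δ g) (hh : SupportedOn Δ h) : SupportedOn Δ (g - h) := by
  intro σ hσ
  by_contra hn
  exact hσ (by simp [not_not.1 (mt (hg σ) hn), not_not.1 (mt (hh σ) hn)])

variable [DecidableEq V] [Fintype V]

/-- The boundary operator of the augmented chain complex of the full simplex on `V`; a chain is a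
function on all faces, the empty one included. -/
def boundary (o : V → ℕ) (g : Finset V → A) (τ : Finset V) : A :=
  ∑ v ∈ τᶜ, incidenceSign o v τ • g (insert v τ)

theorem boundary_add (o : V → ℕ) (g h : Finset V → A) :
    boundary o (g + h) = boundary o g + boundary o h := by
  ext τ; simp [boundary, Finset.sum_add_distrib]

theorem boundary_sub (o : V → ℕ) (g h : Finset V → A) :
    boundary o (g - h) = boundary o g - boundary o h := by
  ext τ; simp [boundary, smul_sub]

theorem map_boundary {B : Type*} [AddCommGroup B] (φ : A →+ B) (o : V → ℕ) (g : Finset V → A)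
    (τ : Finset V) : φ (boundary o g τ) = boundary o (fun σ => φ (g σ)) τ := by
  simp [boundary]

theorem boundary_boundary {o : V → ℕ} (ho : Function.Injective o) (g : Finset V → A) :
    boundary o (boundary o g) = 0 := by
  ext τ
  simp only [boundary, Finset.smul_sum, Pi.zero_apply, smul_smul]
  rw [Finset.sum_sigma']
  refine Finset.sum_involution (fun p _ => ⟨p.2, p.1⟩) ?_ ?_ ?_ ?_
  · rintro ⟨v, w⟩ h
    simp only [Finset.mem_sigma, Finset.mem_compl, Finset.mem_insert, not_or] at h
    simp only
    rw [incidenceSign_swap ho h.1 h.2.2 (Ne.symm h.2.1), Finset.insert_comm, neg_smul,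
      neg_add_cancel]
  · rintro ⟨v, w⟩ h _ heq
    simp only [Finset.mem_sigma, Finset.mem_compl, Finset.mem_insert, not_or] at h
    simp only [Sigma.mk.injEq] at heq
    exact h.2.1 heq.1
  · rintro ⟨v, w⟩ h
    simp only [Finset.mem_sigma, Finset.mem_compl, Finset.mem_insert, not_or] at h ⊢
    exact ⟨h.2.2, Ne.symm h.2.1, h.1⟩
  · rintro ⟨v, w⟩ h
    rfl

theorem SupportedOn.boundary {Δ : Set (Finset V)} (hΔ : IsLowerSet Δ) {g : Finset V → A}
    (hg : SupportedOn Δ g) (o : V → ℕ) : SupportedOn Δ (boundary o g) := by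
  intro τ hτ
  obtain ⟨v, _, hv⟩ := Finset.exists_ne_zero_of_sum_ne_zero hτ
  exact hΔ (Finset.subset_insert v τ) (hg _ fun h => hv (by rw [h, smul_zero]))

variable (A) in
/-- The reduced homology of `Δ` with coefficients in `A` vanishes: every cycle supported on `Δ` is
the boundary of a chain supported on `Δ`. -/
def Acyclic (o : V → ℕ) (Δ : Set (Finset V)) : Prop :=
  ∀ z : Finset V → A, SupportedOn Δ z → boundary o z = 0 →
    ∃ w : Finset V → A, SupportedOn Δ w ∧ boundary o w = z

/-- A cone is acyclic. -/
theorem Acyclic.of_cone {o : V → ℕ} (ho : Function.Injective o) {Δ : Set (Finset V)} (v₀ : V)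
    (hΔ : ∀ σ ∈ Δ, insert v₀ σ ∈ Δ) : Acyclic A o Δ := by
  intro z hz hdz
  -- The bounding chain is the cone over `z` with apex `v₀`.
  refine ⟨fun σ => if v₀ ∈ σ then incidenceSign o v₀ (σ.erase v₀) • z (σ.erase v₀) else 0, ?_, ?_⟩
  · intro σ hσ
    simp only [ne_eq, ite_eq_right_iff, Classical.not_imp] at hσ
    have := hΔ _ (hz (σ.erase v₀) fun h => hσ.2 (by rw [h, smul_zero]))
    rwa [Finset.insert_erase hσ.1] at this
  · ext τ
    by_cases hτ : v₀ ∈ τ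
    · obtain ⟨ρ, hρ, rfl⟩ : ∃ ρ, v₀ ∉ ρ ∧ insert v₀ ρ = τ :=
        ⟨τ.erase v₀, Finset.notMem_erase _ _, Finset.insert_erase hτ⟩
      -- For `τ ∋ v₀`, the cycle condition at `τ` without `v₀` expresses `z τ` through the terms
      -- occurring in the boundary of the cone.
      have h0 : boundary o z ρ = 0 := by rw [hdz]; rfl
      unfold boundary at h0 ⊢
      have hc : ρᶜ = insert v₀ (insert v₀ ρ)ᶜ := by
        ext x; by_cases hx : x = v₀ <;> simp [hx, hρ]
      rw [hc, Finset.sum_insert (by simp)] at h0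
      have h1 : ∀ v ∈ (insert v₀ ρ)ᶜ,
          incidenceSign o v (insert v₀ ρ) •
            (if v₀ ∈ insert v (insert v₀ ρ) then
              incidenceSign o v₀ ((insert v (insert v₀ ρ)).erase v₀) •
                z ((insert v (insert v₀ ρ)).erase v₀) else 0) =
          -(incidenceSign o v₀ ρ • (incidenceSign o v ρ • z (insert v ρ))) := by
        intro v hv
        simp only [Finset.mem_compl, Finset.mem_insert, not_or] at hv
        have he : (insert v (insert v₀ ρ)).erase v₀ = insert v ρ := by
          rw [Finset.erase_insert_of_ne hv.1, Finset.erase_insert hρ]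
        rw [if_pos (by simp), he, smul_smul, smul_smul, ← neg_smul]
        congr 1
        have h2 := incidenceSign_swap ho hρ hv.2 (Ne.symm hv.1)
        have h3 := incidenceSign_mul_self o v₀ ρ
        have h4 := incidenceSign_mul_self o v₀ (insert v ρ)
        linear_combination (incidenceSign o v₀ ρ * incidenceSign o v₀ (insert v ρ)) * h2 -
          incidenceSign o v (insert v₀ ρ) * incidenceSign o v₀ (insert v ρ) * h3 -
          incidenceSign o v₀ ρ * incidenceSign o v ρ * h4
      rw [Finset.sum_congr rfl h1, Finset.sum_neg_distrib, ← Finset.smul_sum,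
        ← neg_eq_of_add_eq_zero_right h0, smul_neg, neg_neg, smul_smul, incidenceSign_mul_self,
        one_smul]
    · unfold boundary
      rw [Finset.sum_eq_single v₀]
      · beta_reduce
        rw [if_pos (by simp), Finset.erase_insert hτ, smul_smul, incidenceSign_mul_self, one_smul]
      · intro v _ hv
        beta_reduce
        rw [if_neg (by simp [hτ, Ne.symm hv]), smul_zero]
      · intro h; simp [hτ] at h

/-- Gluing (Mayer–Vietoris): a union of two acyclic complexes with acyclic intersection is
acyclic. -/
theorem Acyclic.union {o : V → ℕ} (ho : Function.Injective o) {Δ₁ Δ₂ : Set (Finset V)}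
    (hl₁ : IsLowerSet Δ₁) (hl₂ : IsLowerSet Δ₂) (h₁ : Acyclic A o Δ₁) (h₂ : Acyclic A o Δ₂)
    (h₁₂ : Acyclic A o (Δ₁ ∩ Δ₂)) : Acyclic A o (Δ₁ ∪ Δ₂) := by
  classical
  intro z hz hdz
  set z₁ : Finset V → A := fun σ => if σ ∈ Δ₁ then z σ else 0 with hz₁
  have hs₁ : SupportedOn Δ₁ z₁ := by
    intro σ hσ; by_contra h; exact hσ (by simp [hz₁, h])
  have hs₂ : SupportedOn Δ₂ (z - z₁) := by
    intro σ hσ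
    by_cases h : σ ∈ Δ₁
    · exact absurd (by simp [hz₁, h]) hσ
    · refine (hz σ fun h0 => hσ (by simp [hz₁, h, h0])).resolve_left h
  -- Since `z` is a cycle, its two parts have opposite boundaries, so this common boundary lives on
  -- the intersection and bounds some `w` there. Correcting both parts by `w` makes each a cycle.
  have hd : boundary o (z - z₁) = -boundary o z₁ := by rw [boundary_sub, hdz, zero_sub]
  have hs : SupportedOn (Δ₁ ∩ Δ₂) (boundary o z₁) := fun σ hσ =>
    ⟨hs₁.boundary hl₁ o σ hσ, hs₂.boundary hl₂ o σ (by rw [hd]; simpa using hσ)⟩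
  obtain ⟨w, hw, hdw⟩ := h₁₂ _ hs (boundary_boundary ho _)
  obtain ⟨w₁, hw₁, hdw₁⟩ := h₁ (z₁ - w) (hs₁.sub (hw.mono Set.inter_subset_left))
    (by rw [boundary_sub, hdw, sub_self])
  obtain ⟨w₂, hw₂, hdw₂⟩ := h₂ (z - z₁ + w) (hs₂.add (hw.mono Set.inter_subset_right))
    (by rw [boundary_add, hdw, hd, neg_add_cancel])
  refine ⟨w₁ + w₂, (hw₁.mono Set.subset_union_left).add (hw₂.mono Set.subset_union_right), ?_⟩
  rw [boundary_add, hdw₁, hdw₂]; abel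

/-- In an acyclic complex, a homogeneous cycle bounds a homogeneous chain. -/
theorem Acyclic.exists_homogeneous {o : V → ℕ} {Δ : Set (Finset V)} (h : Acyclic A o Δ) {k : ℕ}
    {z : Finset V → A} (hz : SupportedOn {σ | σ ∈ Δ ∧ σ.card = k} z) (hdz : boundary o z = 0) :
    ∃ w : Finset V → A, SupportedOn {σ | σ ∈ Δ ∧ σ.card = k + 1} w ∧ boundary o w = z := by
  obtain ⟨w, hw, hdw⟩ := h z (fun σ hσ => (hz σ hσ).1) hdz
  refine ⟨fun σ => if σ.card = k + 1 then w σ else 0, ?_, ?_⟩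
  · intro σ hσ
    simp only [ne_eq, ite_eq_right_iff, Classical.not_imp] at hσ
    exact ⟨hw σ hσ.2, hσ.1⟩
  · ext τ
    have hc : ∀ v ∈ τᶜ, (insert v τ).card = τ.card + 1 := fun v hv =>
      Finset.card_insert_of_notMem (Finset.mem_compl.1 hv)
    by_cases hτ : τ.card = k
    · rw [← hdw]
      exact Finset.sum_congr rfl fun v hv => by
        beta_reduce; rw [if_pos (by rw [hc v hv, hτ])]
    · have : z τ = 0 := by
        by_contra h0; exact hτ (hz τ h0).2
      rw [this]
      exact Finset.sum_eq_zero fun v hv => by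
        beta_reduce; rw [if_neg (by rw [hc v hv]; omega), smul_zero]

end Boundary

end SimplicialResolution

namespace SimplicialResolution

/-! ### Labelled complexes and the resolutions they support -/

section Labelled

variable {V σ K : Type*} [Field K]

/-- The faces of `Δ` whose vertex labels all divide the monomial `x ^ u`; void if no vertex label
does. -/
def degreeSubcomplex (ℓ : V → σ →₀ ℕ) (Δ : Finset (Finset V)) (u : σ →₀ ℕ) : Set (Finset V) :=
  {τ | τ ∈ Δ ∧ (∀ v ∈ τ, ℓ v ≤ u) ∧ ∃ v, ℓ v ≤ u}

theorem isLowerSet_degreeSubcomplex (ℓ : V → σ →₀ ℕ) {Δ : Finset (Finset V)}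
    (hΔ : IsLowerSet (Δ : Set (Finset V))) (u : σ →₀ ℕ) :
    IsLowerSet (degreeSubcomplex ℓ Δ u) :=
  fun _ _ hle h => ⟨hΔ hle h.1, fun v hv => h.2.1 v (hle hv), h.2.2⟩

/-- The chain `g` lies in the part of rank `k` of the homogenized chain complex of `Δ`: its
coefficient in multidegree `u` is supported on the faces of cardinality `k` of the subcomplex in
degree `u`. -/
def IsHomogenized (ℓ : V → σ →₀ ℕ) (Δ : Finset (Finset V)) (k : ℕ)
    (g : Finset V → MvPolynomial σ K) : Prop :=
  ∀ u, SupportedOn {τ | τ ∈ degreeSubcomplex ℓ Δ u ∧ τ.card = k} fun τ => coeff u (g τ)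

variable [DecidableEq V]

variable (K) in
/-- The embedding of the free module on the faces of cardinality `k` into the chains of the full
simplex, sending the basis element of a face to the least common multiple of its labels. -/
noncomputable def inclusion (ℓ : V → σ →₀ ℕ) (Δ : Finset (Finset V)) (k : ℕ) :
    (Fin (Δ.filter fun τ => τ.card = k).card → MvPolynomial σ K) →ₗ[MvPolynomial σ K]
      (Finset V → MvPolynomial σ K) where
  toFun c τ := if h : τ ∈ Δ.filter fun τ => τ.card = k then
    monomial (τ.sup ℓ) 1 * c ((Δ.filter fun τ => τ.card = k).equivFin ⟨τ, h⟩) else 0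
  map_add' c c' := by
    ext1 τ
    simp only [Pi.add_apply, mul_add]
    split_ifs <;> simp
  map_smul' a c := by
    ext1 τ
    simp only [Pi.smul_apply, smul_eq_mul, mul_left_comm, RingHom.id_apply]
    split_ifs <;> simp

theorem inclusion_injective (ℓ : V → σ →₀ ℕ) (Δ : Finset (Finset V)) (k : ℕ) :
    Function.Injective (inclusion K ℓ Δ k) := by
  rw [injective_iff_map_eq_zero]
  intro c hc
  ext1 i
  obtain ⟨⟨τ, h⟩, rfl⟩ := (Δ.filter fun τ => τ.card = k).equivFin.surjective i
  have := congrFun hc τ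
  simp only [inclusion, LinearMap.coe_mk, AddHom.coe_mk, Pi.zero_apply, dif_pos h] at this
  exact (mul_eq_zero.1 this).resolve_left (by simp)

/-- Divisibility by the least common multiple of the labels can be tested degree by degree. The rank
is `k + 1` because a nonempty face itself supplies the vertex label dividing `x ^ u` that
`degreeSubcomplex` demands. -/
theorem mem_range_inclusion (ℓ : V → σ →₀ ℕ) (Δ : Finset (Finset V)) (k : ℕ)
    (g : Finset V → MvPolynomial σ K) :
    g ∈ LinearMap.range (inclusion K ℓ Δ (k + 1)) ↔ IsHomogenized ℓ Δ (k + 1) g := by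
  constructor
  · rintro ⟨c, rfl⟩ u τ hτ
    simp only [inclusion, LinearMap.coe_mk, AddHom.coe_mk] at hτ
    split_ifs at hτ with h
    · rw [coeff_monomial_mul'] at hτ
      obtain ⟨h₁, h₂⟩ := Finset.mem_filter.1 h
      have hle : τ.sup ℓ ≤ u := by
        by_contra hn; exact hτ (if_neg hn)
      rw [Finset.sup_le_iff] at hle
      obtain ⟨v, hv⟩ := Finset.card_pos.1 (by omega : 0 < τ.card)
      exact ⟨⟨h₁, hle, v, hle v hv⟩, h₂⟩
    · simp at hτ
  · intro hg
    refine ⟨fun i => (g ((Δ.filter fun τ => τ.card = k + 1).equivFin.symm i).1).divMonomial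
      (((Δ.filter fun τ => τ.card = k + 1).equivFin.symm i).1.sup ℓ), ?_⟩
    ext τ u
    simp only [inclusion, LinearMap.coe_mk, AddHom.coe_mk]
    split_ifs with h
    · rw [coeff_monomial_mul', Equiv.symm_apply_apply, coeff_divMonomial, one_mul]
      split_ifs with hle
      · rw [add_tsub_cancel_of_le hle]
      · by_contra hn
        exact hle (Finset.sup_le (hg u τ (Ne.symm hn)).1.2.1)
    · by_contra hn
      have := hg u τ (by simpa [eq_comm] using hn)
      exact h (Finset.mem_filter.2 ⟨this.1.1, this.2⟩)

variable [Fintype V]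

variable (σ K) in
/-- The boundary operator with polynomial coefficients. -/
noncomputable def polyBoundary (o : V → ℕ) :
    (Finset V → MvPolynomial σ K) →ₗ[MvPolynomial σ K] (Finset V → MvPolynomial σ K) where
  toFun := boundary o
  map_add' := boundary_add o
  map_smul' a g := by
    ext1 τ
    exact (map_boundary (AddMonoidHom.mulLeft a) o g τ).symm

theorem coeff_boundary (o : V → ℕ) (g : Finset V → MvPolynomial σ K) (u : σ →₀ ℕ) :
    (fun τ => coeff u (boundary o g τ)) = boundary o fun τ => coeff u (g τ) :=
  funext fun τ => map_boundary (coeffAddMonoidHom u) o g τ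

theorem IsHomogenized.boundary {ℓ : V → σ →₀ ℕ} {Δ : Finset (Finset V)}
    (hΔ : IsLowerSet (Δ : Set (Finset V))) {k : ℕ} {g : Finset V → MvPolynomial σ K}
    (hg : IsHomogenized ℓ Δ (k + 1) g) (o : V → ℕ) : IsHomogenized ℓ Δ k (boundary o g) := by
  intro u τ hτ
  have hτ' := hτ
  rw [coeff_boundary] at hτ
  refine ⟨SupportedOn.boundary (isLowerSet_degreeSubcomplex ℓ hΔ u)
    (fun ρ hρ => (hg u ρ hρ).1) o τ hτ, ?_⟩
  obtain ⟨v, hv, hne⟩ := Finset.exists_ne_zero_of_sum_ne_zero hτ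
  have := (hg u _ fun h => hne (by rw [h, smul_zero])).2
  rw [Finset.card_insert_of_notMem (Finset.mem_compl.1 hv)] at this
  omega

/-- Exactness of the homogenized complex, from the acyclicity of all degree subcomplexes. -/
theorem IsHomogenized.exists_boundary_eq {o : V → ℕ} {ℓ : V → σ →₀ ℕ} {Δ : Finset (Finset V)}
    (hac : ∀ u, Acyclic K o (degreeSubcomplex ℓ Δ u)) {k : ℕ} {g : Finset V → MvPolynomial σ K}
    (hg : IsHomogenized ℓ Δ k g) (hdg : SimplicialResolution.boundary o g = 0) :
    ∃ w : Finset V → MvPolynomial σ K,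
      IsHomogenized ℓ Δ (k + 1) w ∧ SimplicialResolution.boundary o w = g := by
  classical
  have hex : ∀ u, ∃ w : Finset V → K,
      SupportedOn {τ | τ ∈ degreeSubcomplex ℓ Δ u ∧ τ.card = k + 1} w ∧
        SimplicialResolution.boundary o w = fun τ => coeff u (g τ) := fun u =>
    (hac u).exists_homogeneous (hg u) (by rw [← coeff_boundary, hdg]; ext; simp)
  choose w hw hdw using hex
  -- Only the finitely many multidegrees occurring in `g` are lifted, so that the lifts sum to
  -- polynomials.
  set U : Finset (σ →₀ ℕ) := Finset.univ.biUnion fun τ => (g τ).support with hU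
  have hcoeff : ∀ u τ, coeff u (∑ u' ∈ U, monomial u' (w u' τ)) = if u ∈ U then w u τ else 0 := by
    intro u τ
    simp [coeff_sum, coeff_monomial]
  refine ⟨fun τ => ∑ u ∈ U, monomial u (w u τ), ?_, ?_⟩
  · intro u τ hτ
    beta_reduce at hτ
    rw [hcoeff] at hτ
    split_ifs at hτ with h
    · exact hw u τ hτ
    · simp at hτ
  · ext τ u
    have := congrFun (coeff_boundary o (fun τ => ∑ u ∈ U, monomial u (w u τ)) u) τ
    rw [this]
    simp only [hcoeff]
    split_ifs with h
    · exact congrFun (hdw u) τ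
    · have h0 : coeff u (g τ) = 0 := by
        by_contra hn
        exact h (Finset.mem_biUnion.2 ⟨τ, Finset.mem_univ _, mem_support_iff.2 hn⟩)
      rw [h0]
      simp [SimplicialResolution.boundary]

section Construction

variable (K) (o : V → ℕ) (ℓ : V → σ →₀ ℕ) {Δ : Finset (Finset V)}

/-- The differential of the homogenized complex. -/
noncomputable def differential (hΔ : IsLowerSet (Δ : Set (Finset V))) (k : ℕ) :
    (Fin (Δ.filter fun τ => τ.card = k + 2).card → MvPolynomial σ K) →ₗ[MvPolynomial σ K]
      (Fin (Δ.filter fun τ => τ.card = k + 1).card → MvPolynomial σ K) :=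
  (LinearEquiv.ofInjective (inclusion K ℓ Δ (k + 1)) (inclusion_injective ℓ Δ (k + 1))).symm ∘ₗ
    (polyBoundary σ K o ∘ₗ inclusion K ℓ Δ (k + 2)).codRestrict _ fun c =>
      (mem_range_inclusion ℓ Δ k _).2
        (((mem_range_inclusion ℓ Δ (k + 1) _).1 ⟨c, rfl⟩).boundary hΔ o)

theorem inclusion_differential (hΔ : IsLowerSet (Δ : Set (Finset V))) (k : ℕ)
    (c : Fin (Δ.filter fun τ => τ.card = k + 2).card → MvPolynomial σ K) :
    inclusion K ℓ Δ (k + 1) (differential K o ℓ hΔ k c) =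
      boundary o (inclusion K ℓ Δ (k + 2) c) :=
  congrArg Subtype.val (LinearEquiv.apply_symm_apply
    (LinearEquiv.ofInjective (inclusion K ℓ Δ (k + 1)) (inclusion_injective ℓ Δ (k + 1))) _)

/-- **Bayer–Peeva–Sturmfels criterion**: if all degree subcomplexes of a labelled simplicial complex
are acyclic, it supports a free resolution of the monomial ideal generated by its labels. -/
theorem exists_freeResolution (hΔ : IsLowerSet (Δ : Set (Finset V))) (ho : Function.Injective o) (hempty : ∅ ∈ Δ)
    (hac : ∀ u, Acyclic K o (degreeSubcomplex ℓ Δ u)) (J : Ideal (MvPolynomial σ K))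
    (hJ : ∀ p, p ∈ J ↔ ∀ u, coeff u p ≠ 0 → ∃ v, ℓ v ≤ u) :
    ∃ F : FreeResolution (MvPolynomial σ K) J,
      ∀ j, F.rank j = (Δ.filter fun τ => τ.card = j + 1).card := by
  have hhom : ∀ c, IsHomogenized ℓ Δ 0 (boundary o (inclusion K ℓ Δ 1 c)) := fun c =>
    ((mem_range_inclusion ℓ Δ 0 _).1 ⟨c, rfl⟩).boundary hΔ o
  -- The boundary of a chain on vertices lives on the empty face alone, so its value there, the
  -- augmentation, determines it.
  have hzero : ∀ c, boundary o (inclusion K ℓ Δ 1 c) ∅ = 0 →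
      boundary o (inclusion K ℓ Δ 1 c) = 0 := by
    intro c hc
    ext τ u
    by_contra hn
    have := (hhom c u τ hn).2
    rw [Finset.card_eq_zero] at this
    subst this
    exact hn (by rw [hc]; rfl)
  have hJmem : ∀ c, boundary o (inclusion K ℓ Δ 1 c) ∅ ∈ J := fun c =>
    (hJ _).2 fun u hu => (hhom c u ∅ hu).1.2.2
  let aug : (Fin (Δ.filter fun τ => τ.card = 0 + 1).card → MvPolynomial σ K)
      →ₗ[MvPolynomial σ K] J :=
    (LinearMap.proj ∅ ∘ₗ polyBoundary σ K o ∘ₗ inclusion K ℓ Δ 1).codRestrict J hJmem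
  have haug : ∀ c, (aug c : MvPolynomial σ K) = boundary o (inclusion K ℓ Δ 1 c) ∅ := fun _ => rfl
  have hlift : ∀ k (c : Fin (Δ.filter fun τ => τ.card = k + 1).card → MvPolynomial σ K),
      boundary o (inclusion K ℓ Δ (k + 1) c) = 0 → ∃ c', differential K o ℓ hΔ k c' = c := by
    intro k c hc
    obtain ⟨w, hw, hdw⟩ :=
      ((mem_range_inclusion ℓ Δ k _).1 ⟨c, rfl⟩).exists_boundary_eq hac hc
    obtain ⟨c', rfl⟩ := (mem_range_inclusion ℓ Δ (k + 1) w).2 hw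
    exact ⟨c', inclusion_injective ℓ Δ (k + 1) (by rw [inclusion_differential, hdw])⟩
  -- Spot `j` carries the faces of dimension `j`, hence of cardinality `j + 1`; the empty face
  -- accounts for the ideal.
  refine ⟨{ rank := fun j => (Δ.filter fun τ => τ.card = j + 1).card
            d := fun j => differential K o ℓ hΔ j
            aug := aug
            aug_surjective := ?_
            exact_zero := ?_
            exact_succ := ?_
            finite_length := ?_ }, fun j => rfl⟩
  · rintro ⟨p, hp⟩
    -- An element of `J`, placed on the empty face, is a cycle, so surjectivity of the augmentation
    -- is one more case of exactness.
    have hg : IsHomogenized ℓ Δ 0 (fun τ : Finset V => if τ = ∅ then p else 0) := by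
      intro u τ hτ
      by_cases h : τ = ∅
      · subst h
        exact ⟨⟨hempty, by simp, (hJ p).1 hp u (by simpa using hτ)⟩, rfl⟩
      · simp [h] at hτ
    obtain ⟨w, hw, hdw⟩ := hg.exists_boundary_eq (o := o) hac (by ext1; simp [boundary])
    obtain ⟨c, rfl⟩ := (mem_range_inclusion ℓ Δ 0 w).2 hw
    exact ⟨c, Subtype.ext (by rw [haug, hdw]; simp)⟩
  · intro c
    constructor
    · intro hc
      exact hlift 0 c (hzero c (by rw [← haug, hc]; rfl))
    · rintro ⟨c', rfl⟩
      refine Subtype.ext ?_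
      rw [haug, inclusion_differential, boundary_boundary ho]; rfl
  · intro j c
    constructor
    · intro hc
      exact hlift (j + 1) c (by rw [← inclusion_differential K o ℓ hΔ, hc, map_zero])
    · rintro ⟨c', rfl⟩
      refine inclusion_injective ℓ Δ (j + 1) ?_
      rw [inclusion_differential, inclusion_differential, boundary_boundary ho, map_zero]
  · refine ⟨Fintype.card V, fun j hj => ?_⟩
    rw [Finset.card_eq_zero, Finset.filter_eq_empty_iff]
    intro τ _ hτ
    have := Finset.card_le_univ τ
    omega

end Construction

end Labelled

end SimplicialResolution

namespace SimplicialResolution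

/-! ### The complex for the `r`-th power and its acyclicity -/

section PowerComplex

/-- The exponent vectors of the products of `r` among `q` generators. -/
abbrev ExponentVector (q r : ℕ) : Type :=
  {a : Fin q → ℕ // a ∈ Finset.piAntidiag Finset.univ r}

variable {q r : ℕ}

theorem ExponentVector.sum_eq (a : ExponentVector q r) : ∑ i, a.1 i = r :=
  (Finset.mem_piAntidiag.1 a.2).1

/-- Constructor from a function with the right sum. -/
def ExponentVector.mk (a : Fin q → ℕ) (ha : ∑ i, a i = r) : ExponentVector q r :=
  ⟨a, Finset.mem_piAntidiag.2 ⟨ha, fun _ _ => Finset.mem_univ _⟩⟩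

theorem exists_sum_split {i j : Fin q} (hij : i ≠ j) :
    ∃ T : Finset (Fin q), i ∉ T ∧ j ∉ T ∧ (∀ k, k ≠ i → k ≠ j → k ∈ T) ∧
      ∀ F : Fin q → ℕ, ∑ k, F k = F i + F j + ∑ k ∈ T, F k := by
  refine ⟨(Finset.univ.erase i).erase j, by simp, by simp, by simp +contextual, fun F => ?_⟩
  rw [← Finset.add_sum_erase _ F (Finset.mem_univ i),
    ← Finset.add_sum_erase _ F (show j ∈ Finset.univ.erase i by simp [hij.symm]), add_assoc]

theorem ExponentVector.le (a : ExponentVector q r) (i : Fin q) : a.1 i ≤ r := by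
  exact (Finset.single_le_sum (f := a.1) (fun _ _ => Nat.zero_le _) (Finset.mem_univ i)).trans
    a.sum_eq.le

theorem ExponentVector.add_le (a : ExponentVector q r) {i j : Fin q} (hij : i ≠ j) :
    a.1 i + a.1 j ≤ r := by
  obtain ⟨T, -, -, -, hT⟩ := exists_sum_split hij
  have := hT a.1
  rw [a.sum_eq] at this
  omega

theorem ExponentVector.eq_of_apply_eq {a b : ExponentVector q r} {i : Fin q} (ha : a.1 i = r)
    (hb : b.1 i = r) : a = b := by
  ext k
  by_cases hk : k = i
  · rw [hk, ha, hb]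
  · have h₁ := a.add_le hk
    have h₂ := b.add_le hk
    omega

variable (q r) in
/-- The exponent vectors all of whose entries are at most `⌈r / 2⌉`. -/
def baseVertices : Finset (ExponentVector q r) :=
  Finset.univ.filter fun a => ∀ j, a.1 j ≤ (r + 1) / 2

variable (r) in
/-- The exponent vectors whose entries are at most `⌈r / 2⌉` except for the `i`-th, which is at most
`r - 1`. -/
def sideVertices (i : Fin q) : Finset (ExponentVector q r) :=
  Finset.univ.filter fun a => a.1 i < r ∧ ∀ j, j ≠ i → a.1 j ≤ (r + 1) / 2

variable (r) in
/-- The exponent vectors whose `i`-th entry is at least `r - 1`. -/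
def cornerVertices (i : Fin q) : Finset (ExponentVector q r) :=
  Finset.univ.filter fun a => r ≤ a.1 i + 1

variable (q r) in
/-- The simplicial complex with facets the sets `sideVertices r i` and `cornerVertices r i`. -/
def powerComplex : Finset (Finset (ExponentVector q r)) :=
  Finset.univ.filter fun τ => (∃ i, τ ⊆ sideVertices r i) ∨ ∃ i, τ ⊆ cornerVertices r i

theorem isLowerSet_powerComplex :
    IsLowerSet (powerComplex q r : Set (Finset (ExponentVector q r))) := by
  intro τ ρ hle h
  simp only [powerComplex, Finset.coe_filter, Finset.mem_univ, true_and, Set.mem_ofPred_eq] at h ⊢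
  exact h.imp (fun ⟨i, hi⟩ => ⟨i, hle.trans hi⟩) (fun ⟨i, hi⟩ => ⟨i, hle.trans hi⟩)

theorem baseVertices_subset_sideVertices (hr : 2 ≤ r) (i : Fin q) :
    baseVertices q r ⊆ sideVertices r i := by
  intro a ha
  simp only [baseVertices, sideVertices, Finset.mem_filter, Finset.mem_univ, true_and] at ha ⊢
  exact ⟨by have := ha i; omega, fun j _ => ha j⟩

theorem mem_sideVertices_of_corner (hr : 2 ≤ r) {a : ExponentVector q r} {i : Fin q}
    (h : a.1 i + 1 = r) : a ∈ sideVertices r i := by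
  simp only [sideVertices, Finset.mem_filter, Finset.mem_univ, true_and]
  exact ⟨by omega, fun j hj => by have := a.add_le hj; omega⟩

/-- At most one entry can exceed `⌈r / 2⌉`, since the sum is `r`; the index `i₀` serves when none
does. -/
theorem exists_mem_sideVertices {i₀ : Fin q} {a : ExponentVector q r}
    (ha : ∀ i, a.1 i < r) : ∃ i, a ∈ sideVertices r i := by
  simp only [sideVertices, Finset.mem_filter, Finset.mem_univ, true_and]
  by_cases h : ∃ i, (r + 1) / 2 < a.1 i
  · obtain ⟨i, hi⟩ := h
    exact ⟨i, ha i, fun j hj => by have := a.add_le hj; omega⟩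
  · push Not at h
    exact ⟨i₀, ha i₀, fun j _ => h j⟩

variable {σ : Type*}

/-- The exponent of the product of the generators with exponents `e` along `a`. -/
noncomputable def exponentLabel (e : Fin q → σ →₀ ℕ) (a : ExponentVector q r) : σ →₀ ℕ :=
  ∑ i, a.1 i • e i

theorem exponentLabel_apply (e : Fin q → σ →₀ ℕ) (a : ExponentVector q r) (x : σ) :
    exponentLabel e a x = ∑ i, a.1 i * e i x := by
  simp [exponentLabel, Finsupp.finsetSum_apply]

theorem mul_le_exponentLabel (e : Fin q → σ →₀ ℕ) (a : ExponentVector q r) (i : Fin q) (x : σ) :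
    a.1 i * e i x ≤ exponentLabel e a x := by
  rw [exponentLabel_apply]
  exact Finset.single_le_sum (f := fun i => a.1 i * e i x) (fun _ _ => Nat.zero_le _)
    (Finset.mem_univ i)

variable {e : Fin q → σ →₀ ℕ} {u : σ →₀ ℕ}

/-- If a pure power and another product divide a monomial, so does a neighbour of the pure power. -/
theorem exists_corner_neighbour (he : ∀ i x, e i x ≤ 1) (hr : 2 ≤ r) {a a' : ExponentVector q r}
    (ha : exponentLabel e a ≤ u) (ha' : exponentLabel e a' ≤ u) {i : Fin q} (hi : a.1 i = r)
    (hi' : a'.1 i < r) : ∃ b : ExponentVector q r, exponentLabel e b ≤ u ∧ b.1 i + 1 = r := by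
  obtain ⟨j, hj, hj0⟩ : ∃ j, j ≠ i ∧ 0 < a'.1 j := by
    by_contra! h
    have := a'.sum_eq
    rw [Finset.sum_eq_single i (fun j _ hj => by have := h j hj; omega) (by simp)] at this
    omega
  obtain ⟨T, hiT, hjT, -, hT⟩ := exists_sum_split hj.symm
  -- One factor `m_i` of the pure power is traded for a factor `m_j` of the other product. A
  -- variable dividing `m_i` has exponent at least `r` in `x ^ u`; any other needs at most exponent
  -- one, which `a'` supplies.
  set c : Fin q → ℕ := fun k => if k = i then r - 1 else if k = j then 1 else 0 with hc
  have hci : c i = r - 1 := by simp [hc]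
  have hcj : c j = 1 := by simp [hc, hj]
  have hz : ∀ k ∈ T, c k = 0 := fun k hk => by
    simp only [hc]
    rw [if_neg (ne_of_mem_of_not_mem hk hiT), if_neg (ne_of_mem_of_not_mem hk hjT)]
  refine ⟨ExponentVector.mk c ?_, fun x => ?_, ?_⟩
  · rw [hT c, Finset.sum_eq_zero hz, hci, hcj]
    omega
  · rw [exponentLabel_apply]
    change ∑ k, c k * e k x ≤ u x
    rw [hT fun k => c k * e k x, Finset.sum_eq_zero fun k hk => by rw [hz k hk, zero_mul], hci, hcj]
    have h₁ := (mul_le_exponentLabel e a i x).trans (ha x)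
    have h₂ := (mul_le_exponentLabel e a' j x).trans (ha' x)
    have h₃ := he i x
    have h₅ : e j x ≤ a'.1 j * e j x := Nat.le_mul_of_pos_left _ hj0
    have h₄ := he j x
    rw [hi] at h₁
    rcases Nat.le_one_iff_eq_zero_or_eq_one.1 h₃ with h | h <;> rw [h] at h₁ ⊢ <;> omega
  · change c i + 1 = r
    omega

/-- If two products dividing a monomial are dominated by different generators, some balanced product
divides the monomial too. -/
theorem exists_mem_baseVertices (he : ∀ i x, e i x ≤ 1) {a a' : ExponentVector q r}
    (ha : exponentLabel e a ≤ u) (ha' : exponentLabel e a' ≤ u) {i j : Fin q} (hij : i ≠ j)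
    (hi : (r + 1) / 2 < a.1 i) (hj : (r + 1) / 2 < a'.1 j) :
    ∃ b ∈ baseVertices q r, exponentLabel e b ≤ u := by
  obtain ⟨T, hiT, hjT, hTm, hT⟩ := exists_sum_split hij
  -- The excess of the `i`-th entry over `⌈r / 2⌉` moves to `j`. Only variables dividing `m_j` but
  -- not `m_i` gain exponent, and theirs is at most `r - ⌈r / 2⌉ < a'.1 j`.
  set c : Fin q → ℕ := fun k => if k = i then (r + 1) / 2 else
    if k = j then a.1 j + (a.1 i - (r + 1) / 2) else a.1 k with hc
  have hci : c i = (r + 1) / 2 := by simp [hc]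
  have hcj : c j = a.1 j + (a.1 i - (r + 1) / 2) := by simp [hc, hij.symm]
  have hz : ∀ k, k ≠ i → k ≠ j → c k = a.1 k := fun k hki hkj => by
    simp only [hc]; rw [if_neg hki, if_neg hkj]
  have hzT : ∀ k ∈ T, c k = a.1 k := fun k hk =>
    hz k (ne_of_mem_of_not_mem hk hiT) (ne_of_mem_of_not_mem hk hjT)
  have hsum : r = a.1 i + a.1 j + ∑ k ∈ T, a.1 k := a.sum_eq.symm.trans (hT a.1)
  refine ⟨ExponentVector.mk c ?_, ?_, fun x => ?_⟩
  · rw [hT c, show ∑ k ∈ T, c k = ∑ k ∈ T, a.1 k from Finset.sum_congr rfl hzT, hci, hcj]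
    omega
  · simp only [baseVertices, Finset.mem_filter, Finset.mem_univ, true_and]
    change ∀ k, c k ≤ (r + 1) / 2
    intro k
    have h₁ := a.add_le hij
    by_cases hki : k = i
    · rw [hki, hci]
    · by_cases hkj : k = j
      · rw [hkj, hcj]; omega
      · rw [hz k hki hkj]
        have := a.add_le hki
        omega
  · rw [exponentLabel_apply]
    change ∑ k, c k * e k x ≤ u x
    rw [hT fun k => c k * e k x, Finset.sum_congr rfl fun k hk => by rw [hzT k hk], hci, hcj]
    have h₁ := ha x
    rw [exponentLabel_apply, hT fun k => a.1 k * e k x] at h₁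
    have h₂ := (mul_le_exponentLabel e a' j x).trans (ha' x)
    have h₃ := he i x
    have h₄ := he j x
    have h₅ : ∑ k ∈ T, a.1 k * e k x ≤ ∑ k ∈ T, a.1 k :=
      Finset.sum_le_sum fun k _ => by simpa using Nat.mul_le_mul_left (a.1 k) (he k x)
    rcases Nat.le_one_iff_eq_zero_or_eq_one.1 h₃ with h | h <;>
      rcases Nat.le_one_iff_eq_zero_or_eq_one.1 h₄ with h' | h' <;>
      rw [h, h'] at h₁ ⊢ <;> rw [h'] at h₂ <;> omega

/-- Acyclicity of the complex whose facets are all the side simplices and those corner simplices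
indexed by `T`, restricted to a set `W` of vertices that is closed under balancing and under passing
from a pure power to a neighbour. -/
theorem acyclic_induced_powerComplex {A : Type*} [AddCommGroup A] (hq : 1 ≤ q) (hr : 2 ≤ r)
    {o : ExponentVector q r → ℕ} (ho : Function.Injective o) (W : ExponentVector q r → Prop)
    {a : ExponentVector q r} (haW : W a) (ha : ∀ i, a.1 i < r)
    (hcor : ∀ p i, W p → p.1 i = r → ∃ b, W b ∧ b.1 i + 1 = r)
    (hbal : ∀ (v w : ExponentVector q r) (i j : Fin q), W v → W w → i ≠ j →
      (r + 1) / 2 < v.1 i → (r + 1) / 2 < w.1 j → ∃ b ∈ baseVertices q r, W b)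
    (T : Finset (Fin q)) :
    Acyclic A o {τ | ((∃ i, τ ⊆ sideVertices r i) ∨ ∃ i ∈ T, τ ⊆ cornerVertices r i) ∧
      ∀ v ∈ τ, W v} := by
  induction T using Finset.induction_on with
  | empty =>
    by_cases hb : ∃ b ∈ baseVertices q r, W b
    · obtain ⟨b, hb, hbW⟩ := hb
      refine Acyclic.of_cone ho b ?_
      rintro τ ⟨⟨i, hi⟩ | ⟨i, hi, -⟩, hτ⟩
      · refine ⟨Or.inl ⟨i, Finset.insert_subset ?_ hi⟩, by simpa [hbW] using hτ⟩
        exact baseVertices_subset_sideVertices hr i hb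
      · simp at hi
    · obtain ⟨i₀, hi₀⟩ := exists_mem_sideVertices (i₀ := ⟨0, hq⟩) ha
      -- Without a balanced vertex in `W`, every side vertex in `W` is dominated, and `hbal` forces
      -- one common index: a single simplex is left.
      have hdom : ∀ i v, W v → v ∈ sideVertices r i → (r + 1) / 2 < v.1 i := by
        intro i v hv hvi
        by_contra hn
        refine hb ⟨v, ?_, hv⟩
        simp only [sideVertices, baseVertices, Finset.mem_filter, Finset.mem_univ,
          true_and] at hvi ⊢
        intro j
        by_cases hj : j = i
        · subst hj; omega
        · exact hvi.2 j hj
      refine Acyclic.of_cone ho a ?_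
      rintro τ ⟨⟨i, hi⟩ | ⟨i, hi, -⟩, hτ⟩
      · refine ⟨Or.inl ?_, by simpa [haW] using hτ⟩
        rcases τ.eq_empty_or_nonempty with rfl | ⟨t, ht⟩
        · exact ⟨i₀, by simpa using hi₀⟩
        · have hii : i = i₀ := by
            by_contra hne
            exact hb (hbal t a i i₀ (hτ t ht) haW hne
              (hdom i t (hτ t ht) (hi ht)) (hdom i₀ a haW hi₀))
          subst hii
          exact ⟨i, Finset.insert_subset hi₀ hi⟩
      · simp at hi
  | insert i T hiT ih =>
    have hun : {τ | ((∃ j, τ ⊆ sideVertices r j) ∨ ∃ j ∈ insert i T, τ ⊆ cornerVertices r j) ∧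
          ∀ v ∈ τ, W v} =
        {τ | ((∃ j, τ ⊆ sideVertices r j) ∨ ∃ j ∈ T, τ ⊆ cornerVertices r j) ∧
          ∀ v ∈ τ, W v} ∪ {τ | τ ⊆ cornerVertices r i ∧ ∀ v ∈ τ, W v} := by
      ext τ
      simp only [Finset.mem_insert, exists_eq_or_imp, Set.mem_ofPred_eq, Set.mem_union]
      rw [or_comm (a := τ ⊆ cornerVertices r i), ← or_assoc, or_and_right]
    have hside : ∀ v : ExponentVector q r, v ∈ cornerVertices r i → v.1 i < r →
        v ∈ sideVertices r i := by
      intro v hv hlt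
      simp only [cornerVertices, Finset.mem_filter, Finset.mem_univ, true_and] at hv
      exact mem_sideVertices_of_corner hr (by omega)
    rw [hun]
    by_cases hp : ∃ p, W p ∧ p.1 i = r
    · obtain ⟨p, hpW, hp⟩ := hp
      obtain ⟨b, hbW, hb⟩ := hcor p i hpW hp
      have hbc : b ∈ cornerVertices r i := by
        simp only [cornerVertices, Finset.mem_filter, Finset.mem_univ, true_and]; omega
      -- The new corner simplex is a cone with apex `p`. Its faces in the earlier complex avoid `p`,
      -- so they lie in the `i`-th side simplex, and the intersection is a cone with apex `b`.
      refine Acyclic.union ho ?_ ?_ ih (Acyclic.of_cone ho p ?_) (Acyclic.of_cone ho b ?_)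
      · rintro τ ρ hle ⟨h, hτ⟩
        exact ⟨h.imp (fun ⟨i, hi⟩ => ⟨i, hle.trans hi⟩)
          (fun ⟨i, hT, hi⟩ => ⟨i, hT, hle.trans hi⟩), fun v hv => hτ v (hle hv)⟩
      · rintro τ ρ hle ⟨h, hτ⟩
        exact ⟨hle.trans h, fun v hv => hτ v (hle hv)⟩
      · rintro τ ⟨h, hτ⟩
        refine ⟨Finset.insert_subset ?_ h, by simpa [hpW] using hτ⟩
        simp only [cornerVertices, Finset.mem_filter, Finset.mem_univ, true_and]; omega
      · rintro τ ⟨⟨h, hτ⟩, h', -⟩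
        have hτb : ∀ v ∈ insert b τ, W v := by simpa [hbW] using hτ
        refine ⟨⟨Or.inl ⟨i, Finset.insert_subset (mem_sideVertices_of_corner hr hb) ?_⟩, hτb⟩,
          Finset.insert_subset hbc h', hτb⟩
        intro t ht
        refine hside t (h' ht) ?_
        rcases h with ⟨k, hk⟩ | ⟨k, hkT, hk⟩
        · have := hk ht
          simp only [sideVertices, Finset.mem_filter, Finset.mem_univ, true_and] at this
          by_cases hki : k = i
          · subst hki; exact this.1
          · have := this.2 i (Ne.symm hki); omega
        · have hki : k ≠ i := fun h => hiT (h ▸ hkT)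
          have := hk ht
          simp only [cornerVertices, Finset.mem_filter, Finset.mem_univ, true_and] at this
          have := t.add_le hki
          omega
    -- Without its pure power, the corner simplex is already inside a side simplex.
    · rwa [Set.union_eq_self_of_subset_right]
      rintro τ ⟨h, hτ⟩
      refine ⟨Or.inl ⟨i, fun t ht => hside t (h ht) ?_⟩, hτ⟩
      exact lt_of_le_of_ne (t.le i) fun heq => hp ⟨t, hτ t ht, heq⟩

/-- The degree subcomplexes of the power complex are acyclic when the generators are
square-free. -/
theorem acyclic_degreeSubcomplex_powerComplex {A : Type*} [AddCommGroup A] (hq : 1 ≤ q)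
    (hr : 2 ≤ r) (he : ∀ i x, e i x ≤ 1) {o : ExponentVector q r → ℕ}
    (ho : Function.Injective o) (u : σ →₀ ℕ) :
    Acyclic A o (degreeSubcomplex (exponentLabel e) (powerComplex q r) u) := by
  set W : ExponentVector q r → Prop := fun a => exponentLabel e a ≤ u with hW
  have hmem : ∀ τ, τ ∈ degreeSubcomplex (exponentLabel e) (powerComplex q r) u ↔
      ((∃ i, τ ⊆ sideVertices r i) ∨ ∃ i, τ ⊆ cornerVertices r i) ∧ (∀ v ∈ τ, W v) ∧ ∃ v, W v := by
    intro τ; simp [degreeSubcomplex, powerComplex, hW]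
  by_cases hmain : ∃ a, W a ∧ ∀ i, a.1 i < r
  · obtain ⟨a, haW, ha⟩ := hmain
    have key := acyclic_induced_powerComplex (A := A) hq hr ho W haW ha
      (fun p i hpW hp => exists_corner_neighbour he hr hpW haW hp (ha i))
      (fun v w i j hv hw => exists_mem_baseVertices he hv hw)
    convert key Finset.univ using 1
    ext τ
    rw [hmem]
    simp only [Finset.mem_univ, true_and, Set.mem_ofPred_eq]
    exact and_congr_right fun _ => ⟨fun h => h.1, fun h => ⟨h, a, haW⟩⟩
  · have hpure : ∀ v, W v → ∃ i, v.1 i = r := by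
      intro v hv
      by_contra! h
      exact hmain ⟨v, hv, fun i => lt_of_le_of_ne (v.le i) (h i)⟩
    -- Two distinct pure powers would yield a balanced product, which is not pure as `r ≥ 2`. So at
    -- most one vertex remains.
    have huniq : ∀ v w, W v → W w → v = w := by
      intro v w hv hw
      obtain ⟨i, hi⟩ := hpure v hv
      obtain ⟨j, hj⟩ := hpure w hw
      by_cases hij : i = j
      · subst hij; exact ExponentVector.eq_of_apply_eq hi hj
      · obtain ⟨b, hb, hbW⟩ := exists_mem_baseVertices he hv hw hij (by omega) (by omega)
        obtain ⟨k, hk⟩ := hpure b hbW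
        simp only [baseVertices, Finset.mem_filter, Finset.mem_univ, true_and] at hb
        have := hb k
        omega
    by_cases hne : ∃ a, W a
    · obtain ⟨a, ha⟩ := hne
      obtain ⟨i, hi⟩ := hpure a ha
      refine Acyclic.of_cone ho a fun τ hτ => ?_
      rw [hmem] at hτ ⊢
      have hW' : ∀ v ∈ insert a τ, W v := by simpa [ha] using hτ.2.1
      refine ⟨Or.inr ⟨i, fun v hv => ?_⟩, hW', a, ha⟩
      rw [huniq v a (hW' v hv) ha]
      simp only [cornerVertices, Finset.mem_filter, Finset.mem_univ, true_and]
      omega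
    · exact Acyclic.of_cone ho (ExponentVector.mk (fun i => if i = ⟨0, hq⟩ then r else 0) (by simp))
        fun τ hτ => absurd ((hmem τ).1 hτ).2.2 hne

end PowerComplex

end SimplicialResolution

namespace SimplicialResolution

/-! ### Vertex and face counts -/

section Counting

variable {q r : ℕ}

variable (q r) in
theorem card_exponentVector : Fintype.card (ExponentVector q r) = (q + r - 1).choose r := by
  have h := Fintype.card_congr (β := ExponentVector q r) ((Sym.equivNatSumOfFintype (Fin q) r).trans
    (Equiv.subtypeEquivRight (q := fun a => a ∈ Finset.piAntidiag Finset.univ r)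
      fun a => by simp))
  rw [← h, Sym.card_sym_eq_choose, Fintype.card_fin]

variable (q r) in
-- Expanding the `q`-fold product picks one exponent at most `⌈r / 2⌉` from each factor.
theorem baseCoeff_eq_card : baseCoeff q r = (baseVertices q r).card := by
  have hceil : ⌈(r : ℚ) / 2⌉₊ = (r + 1) / 2 := by
    apply le_antisymm
    · rw [Nat.ceil_le, div_le_iff₀ two_pos]
      have : r ≤ (r + 1) / 2 * 2 := by omega
      exact_mod_cast this
    · have h : (r : ℚ) ≤ (⌈(r : ℚ) / 2⌉₊ : ℚ) * 2 := (div_le_iff₀ two_pos).1 (Nat.le_ceil _)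
      have h' : r ≤ ⌈(r : ℚ) / 2⌉₊ * 2 := by exact_mod_cast h
      omega
  have hpow : (∑ i ∈ Finset.range ((r + 1) / 2 + 1), (Polynomial.X : Polynomial ℕ) ^ i) ^ q =
      ∏ _j : Fin q, ∑ i ∈ Finset.range ((r + 1) / 2 + 1), (Polynomial.X : Polynomial ℕ) ^ i := by
    simp
  rw [baseCoeff, hceil, hpow, Finset.prod_univ_sum, Polynomial.finsetSum_coeff]
  simp only [Finset.prod_pow_eq_pow_sum, Polynomial.coeff_X_pow]
  rw [← Finset.card_filter, ← Finset.card_map (Function.Embedding.subtype _)]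
  congr 1
  ext a
  simp [baseVertices, and_comm, eq_comm]

theorem card_dominated_eq (i j : Fin q) (c : ℕ) :
    (Finset.univ.filter fun a : ExponentVector q r => c < a.1 i).card =
      (Finset.univ.filter fun a : ExponentVector q r => c < a.1 j).card := by
  have hs : ∀ a : ExponentVector q r, ∑ k, a.1 (Equiv.swap i j k) = r := fun a =>
    (Equiv.sum_comp (Equiv.swap i j) a.1).trans a.sum_eq
  refine Finset.card_nbij' (fun a => ExponentVector.mk (fun k => a.1 (Equiv.swap i j k)) (hs a))
    (fun a => ExponentVector.mk (fun k => a.1 (Equiv.swap i j k)) (hs a)) ?_ ?_ ?_ ?_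
  · intro a ha; simpa [ExponentVector.mk] using ha
  · intro a ha; simpa [ExponentVector.mk] using ha
  · intro a _; ext k; simp [ExponentVector.mk]
  · intro a _; ext k; simp [ExponentVector.mk]

/-- The vertex on which only the `i`-th entry is nonzero. -/
def pureVertex (r : ℕ) (i : Fin q) : ExponentVector q r :=
  ExponentVector.mk (fun k => if k = i then r else 0) (by simp)

theorem pureVertex_apply_self (i : Fin q) : (pureVertex r i).1 i = r := by
  simp [pureVertex, ExponentVector.mk]

/-- The balanced vectors and those dominated by `i` make up the side simplex plus one further
vector, the pure power. -/
theorem card_dominated (hr : 2 ≤ r) (i : Fin q) :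
    (baseVertices q r).card +
        (Finset.univ.filter fun a : ExponentVector q r => (r + 1) / 2 < a.1 i).card =
      (sideVertices r i).card + 1 := by
  have hdisj : Disjoint (baseVertices q r)
      (Finset.univ.filter fun a : ExponentVector q r => (r + 1) / 2 < a.1 i) := by
    rw [Finset.disjoint_left]
    intro a ha ha'
    simp only [baseVertices, Finset.mem_filter, Finset.mem_univ, true_and] at ha ha'
    exact absurd (ha i) (by omega)
  have hp : pureVertex r i ∉ sideVertices r i := by
    simp [sideVertices, pureVertex_apply_self]
  rw [← Finset.card_union_of_disjoint hdisj, ← Finset.card_insert_of_notMem hp]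
  congr 1
  ext a
  simp only [baseVertices, sideVertices, Finset.mem_filter, Finset.mem_univ, true_and,
    Finset.mem_union, Finset.mem_insert]
  constructor
  · rintro (h | h)
    · exact Or.inr ⟨by have := h i; omega, fun j _ => h j⟩
    · rcases (a.le i).eq_or_lt with he | hlt
      · exact Or.inl (ExponentVector.eq_of_apply_eq he (pureVertex_apply_self i))
      · exact Or.inr ⟨hlt, fun j hj => by have := a.add_le hj; omega⟩
  · rintro (rfl | ⟨h, h'⟩)
    · right; rw [pureVertex_apply_self]; omega
    · by_cases hi : (r + 1) / 2 < a.1 i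
      · exact Or.inr hi
      · left
        intro j
        by_cases hj : j = i
        · subst hj; omega
        · exact h' j hj

variable (q r) in
theorem card_exponentVector_eq_add_sum : Fintype.card (ExponentVector q r) =
    (baseVertices q r).card +
      ∑ i, (Finset.univ.filter fun a : ExponentVector q r => (r + 1) / 2 < a.1 i).card := by
  rw [← Finset.card_biUnion, ← Finset.card_union_of_disjoint, ← Finset.card_univ]
  · congr 1
    ext a
    simp only [baseVertices, Finset.mem_filter, Finset.mem_univ, true_and, Finset.mem_union,
      Finset.mem_biUnion, true_iff]
    by_contra! h
    obtain ⟨⟨j, hj⟩, h⟩ := h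
    exact absurd (h j) (by omega)
  · rw [Finset.disjoint_left]
    intro a ha ha'
    simp only [baseVertices, Finset.mem_filter, Finset.mem_univ, true_and,
      Finset.mem_biUnion] at ha ha'
    obtain ⟨i, hi⟩ := ha'
    exact absurd (ha i) (by omega)
  · intro i _ j _ hij
    rw [Function.onFun, Finset.disjoint_left]
    intro a ha ha'
    simp only [Finset.mem_filter, Finset.mem_univ, true_and] at ha ha'
    have := a.add_le hij
    omega

/-- The division-free form of the formula for `f`: coordinate swaps give all indices equally many
dominated vectors, and this number is eliminated from the two counts. -/
theorem exists_card_sideVertices (hq : 1 ≤ q) (hr : 2 ≤ r) :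
    ∃ f, (∀ i, (sideVertices (q := q) r i).card = f) ∧
      (q + r - 1).choose r + (q - 1) * (baseVertices q r).card = q * f + q := by
  refine ⟨(sideVertices r ⟨0, hq⟩).card, fun i => ?_, ?_⟩
  · have h₁ := card_dominated hr i
    have h₂ := card_dominated hr ⟨0, hq⟩
    rw [card_dominated_eq i ⟨0, hq⟩] at h₁
    omega
  · rw [← card_exponentVector, card_exponentVector_eq_add_sum,
      Finset.sum_congr rfl fun i _ => card_dominated_eq i ⟨0, hq⟩ _, Finset.sum_const,
      Finset.card_univ, Fintype.card_fin, smul_eq_mul]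
    have h := card_dominated hr ⟨0, hq⟩
    obtain ⟨p, rfl⟩ : ∃ p, q = p + 1 := ⟨q - 1, by omega⟩
    rw [Nat.add_sub_cancel]
    linear_combination (p + 1) * h

theorem card_corner_neighbours_le (hr : 2 ≤ r) (i : Fin q) :
    (Finset.univ.filter fun a : ExponentVector q r => a.1 i + 1 = r).card ≤ q - 1 := by
  let nb : Fin q → ExponentVector q r := fun j =>
    ExponentVector.mk (fun k => (if k = i then r - 1 else 0) + if k = j then 1 else 0) (by
      rw [Finset.sum_add_distrib]; simp; omega)
  have hsub : (Finset.univ.filter fun a : ExponentVector q r => a.1 i + 1 = r) ⊆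
      (Finset.univ.erase i).image nb := by
    intro a ha
    simp only [Finset.mem_filter, Finset.mem_univ, true_and] at ha
    obtain ⟨j, hj, hj0⟩ : ∃ j, j ≠ i ∧ 0 < a.1 j := by
      by_contra! h
      have := a.sum_eq
      rw [Finset.sum_eq_single i (fun j _ hj => by have := h j hj; omega) (by simp)] at this
      omega
    refine Finset.mem_image.2 ⟨j, by simp [hj], ?_⟩
    ext k
    change (if k = i then r - 1 else 0) + (if k = j then 1 else 0) = a.1 k
    obtain ⟨T, -, -, hTm, hT⟩ := exists_sum_split hj
    have hsum : r = a.1 j + a.1 i + ∑ k ∈ T, a.1 k := a.sum_eq.symm.trans (hT a.1)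
    by_cases hki : k = i
    · subst hki; rw [if_pos rfl, if_neg hj.symm]; omega
    · by_cases hkj : k = j
      · subst hkj; rw [if_neg hki, if_pos rfl]; omega
      · rw [if_neg hki, if_neg hkj]
        have := Finset.single_le_sum (f := a.1) (fun _ _ => Nat.zero_le _) (hTm k hkj hki)
        omega
  refine (Finset.card_le_card hsub).trans (Finset.card_image_le.trans ?_)
  simp

/-- An upper bound for the number of `t`-dimensional faces of the power complex. -/
theorem card_faces_powerComplex_le (hr : 2 ≤ r) {f : ℕ}
    (hf : ∀ i, (sideVertices (q := q) r i).card = f) (t : ℕ) :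
    ((powerComplex q r).filter fun τ => τ.card = t + 1).card ≤
      (baseVertices q r).card.choose (t + 1) +
        q * (f.choose (t + 1) - (baseVertices q r).card.choose (t + 1)) +
        q * (q - 1).choose t := by
  set N : Fin q → Finset (ExponentVector q r) := fun i =>
    Finset.univ.filter fun a => a.1 i + 1 = r with hN
  have hsub : ((powerComplex q r).filter fun τ => τ.card = t + 1) ⊆
      ((baseVertices q r).powersetCard (t + 1) ∪
        Finset.univ.biUnion fun i =>
          (sideVertices r i).powersetCard (t + 1) \ (baseVertices q r).powersetCard (t + 1)) ∪
      Finset.univ.biUnion fun i => ((N i).powersetCard t).image (insert (pureVertex r i)) := by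
    intro τ hτ
    simp only [powerComplex, Finset.mem_filter, Finset.mem_univ, true_and] at hτ
    obtain ⟨hτ, hcard⟩ := hτ
    have hside : (∃ i, τ ⊆ sideVertices r i) → τ ∈ (baseVertices q r).powersetCard (t + 1) ∪
        Finset.univ.biUnion fun i =>
          (sideVertices r i).powersetCard (t + 1) \ (baseVertices q r).powersetCard (t + 1) := by
      rintro ⟨i, hi⟩
      by_cases hb : τ ∈ (baseVertices q r).powersetCard (t + 1)
      · exact Finset.mem_union_left _ hb
      · exact Finset.mem_union_right _ (Finset.mem_biUnion.2 ⟨i, Finset.mem_univ _,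
          Finset.mem_sdiff.2 ⟨Finset.mem_powersetCard.2 ⟨hi, hcard⟩, hb⟩⟩)
    rcases hτ with h | ⟨i, hi⟩
    · exact Finset.mem_union_left _ (hside h)
    · have hmemN : ∀ a ∈ τ, a ≠ pureVertex r i → a.1 i + 1 = r := by
        intro a ha hne
        have h₁ := hi ha
        simp only [cornerVertices, Finset.mem_filter, Finset.mem_univ, true_and] at h₁
        have h₂ := a.le i
        have h₃ : a.1 i ≠ r := fun h =>
          hne (ExponentVector.eq_of_apply_eq h (pureVertex_apply_self i))
        omega
      -- Only corner faces through the pure power are new; each is determined by `t` of its at most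
      -- `q - 1` neighbours.
      by_cases hp : pureVertex r i ∈ τ
      · refine Finset.mem_union_right _ (Finset.mem_biUnion.2 ⟨i, Finset.mem_univ _,
          Finset.mem_image.2 ⟨τ.erase (pureVertex r i), Finset.mem_powersetCard.2 ⟨?_, ?_⟩,
            Finset.insert_erase hp⟩⟩)
        · intro a ha
          simp only [hN, Finset.mem_filter, Finset.mem_univ, true_and]
          exact hmemN a (Finset.mem_of_mem_erase ha) (Finset.ne_of_mem_erase ha)
        · rw [Finset.card_erase_of_mem hp, hcard, Nat.add_sub_cancel]
      · exact Finset.mem_union_left _ (hside ⟨i, fun a ha => mem_sideVertices_of_corner hr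
          (hmemN a ha fun h => hp (h ▸ ha))⟩)
  refine (Finset.card_le_card hsub).trans ((Finset.card_union_le _ _).trans (add_le_add
    ((Finset.card_union_le _ _).trans (add_le_add (Finset.card_powersetCard _ _).le ?_)) ?_))
  · refine (Finset.card_biUnion_le_card_mul _ _ _ fun i _ => ?_).trans_eq
      (by rw [Finset.card_univ, Fintype.card_fin])
    rw [Finset.card_sdiff_of_subset
      (Finset.powersetCard_mono (baseVertices_subset_sideVertices hr i)),
      Finset.card_powersetCard, Finset.card_powersetCard, hf i]
  · refine (Finset.card_biUnion_le_card_mul _ _ _ fun i _ => ?_).trans_eq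
      (by rw [Finset.card_univ, Fintype.card_fin])
    refine Finset.card_image_le.trans ?_
    rw [Finset.card_powersetCard]
    exact Nat.choose_le_choose _ (card_corner_neighbours_le hr i)

end Counting

/-! ### Powers of monomial ideals -/

section PowerIdeal

variable {σ K : Type*} [Field K] {q : ℕ}

theorem prod_X_eq_monomial (A : Finset σ) :
    ∏ x ∈ A, (X x : MvPolynomial σ K) = monomial (∑ x ∈ A, Finsupp.single x 1) 1 := by
  rw [monomial_sum_one]; rfl

theorem sum_single_apply_le_one (A : Finset σ) (x : σ) :
    (∑ y ∈ A, Finsupp.single y 1 : σ →₀ ℕ) x ≤ 1 := by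
  classical
  rw [Finsupp.finsetSum_apply]
  simp only [Finsupp.single_apply, Finset.sum_ite_eq']
  split_ifs <;> simp

/-- The power of an ideal generated by monomials, in terms of the exponents. -/
theorem mem_pow_iff_exponentLabel (e : Fin q → σ →₀ ℕ) (r : ℕ) (p : MvPolynomial σ K) :
    p ∈ Ideal.span (Set.range fun i => (monomial (e i) 1 : MvPolynomial σ K)) ^ r ↔
      ∀ u, coeff u p ≠ 0 → ∃ a : ExponentVector q r, exponentLabel e a ≤ u := by
  have hprod : ∀ a : ExponentVector q r,
      ∏ i, (monomial (e i) (1 : K)) ^ a.1 i = monomial (exponentLabel e a) 1 := by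
    intro a
    simp [exponentLabel, monomial_sum_one, monomial_pow]
  have hspan : Ideal.span (Set.range fun i => (monomial (e i) 1 : MvPolynomial σ K)) ^ r =
      Ideal.span ((fun s => monomial s (1 : K)) '' Set.range (exponentLabel (r := r) e)) := by
    apply le_antisymm
    · rw [Ideal.span, Submodule.span_pow, Submodule.span_le]
      intro x hx
      obtain ⟨g, rfl⟩ := Set.mem_pow.1 hx
      -- `φ` names the generator used by each of the `r` factors; its fibre sizes are the exponent
      -- vector.
      choose φ hφ using fun k => (g k).2
      have hcard : ∑ i, (Finset.univ.filter fun k => φ k = i).card = r := by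
        rw [← Finset.card_eq_sum_card_fiberwise fun k _ => Finset.mem_coe.2 (Finset.mem_univ (φ k))]
        simp
      refine Submodule.subset_span ⟨_, ⟨ExponentVector.mk _ hcard, rfl⟩, ?_⟩
      · change monomial (exponentLabel e _) 1 = _
        rw [← hprod, List.prod_ofFn]
        simp only [ExponentVector.mk]
        rw [← Finset.prod_fiberwise Finset.univ φ]
        refine Finset.prod_congr rfl fun i _ => ?_
        rw [Finset.prod_congr rfl fun k hk => by
          rw [← hφ k, (Finset.mem_filter.1 hk).2], Finset.prod_const]
    · rw [Ideal.span_le]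
      rintro _ ⟨_, ⟨a, rfl⟩, rfl⟩
      have := Ideal.prod_mem_prod (s := Finset.univ)
        (I := fun i => Ideal.span (Set.range fun i => (monomial (e i) 1 : MvPolynomial σ K)) ^ a.1 i)
        (x := fun i => (monomial (e i) (1 : K)) ^ a.1 i)
        (fun i _ => Ideal.pow_mem_pow (Ideal.subset_span (Set.mem_range_self i)) _)
      rwa [hprod, Finset.prod_pow_eq_pow_sum, a.sum_eq] at this
  rw [hspan, mem_ideal_span_monomial_image]
  simp [mem_support_iff]

end PowerIdeal

end SimplicialResolution

/-! ### Betti numbers, projective dimension and the conclusion -/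

namespace FreeResolution

variable {S : Type*} [CommRing S] {M : Type*} [AddCommGroup M] [Module S M]

theorem bettiNumber_le_rank (F : FreeResolution S M) (t : ℕ) : bettiNumber S M t ≤ F.rank t :=
  Nat.sInf_le ⟨F, rfl⟩

/-- The free resolution of the first syzygy module obtained by truncation. -/
def truncate (F : FreeResolution S M) : FreeResolution S (LinearMap.ker F.aug) where
  rank j := F.rank (j + 1)
  d j := F.d (j + 1)
  aug := (F.d 0).codRestrict _ fun x => F.exact_zero.apply_apply_eq_zero x
  aug_surjective := by
    rintro ⟨y, hy⟩
    obtain ⟨x, hx⟩ := (F.exact_zero y).1 hy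
    exact ⟨x, Subtype.ext hx⟩
  exact_zero := fun x => by
    rw [← F.exact_succ 0 x, Subtype.ext_iff]; rfl
  exact_succ j := F.exact_succ (j + 1)
  finite_length := by
    obtain ⟨L, hL⟩ := F.finite_length
    exact ⟨L, fun j hj => hL _ (by omega)⟩

end FreeResolution

-- Dimension shifting: the truncated resolution resolves the first syzygy module, whose projective
-- dimension bound is one lower.
universe u in
open CategoryTheory in
theorem FreeResolution.hasProjectiveDimensionLE {S : Type u} [CommRing S] (N : ℕ) :
    ∀ {M : Type u} [AddCommGroup M] [Module S M] (F : FreeResolution S M)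
      (_ : ∀ j, N < j → F.rank j = 0), HasProjectiveDimensionLE (ModuleCat.of S M) N := by
  induction N with
  | zero =>
    intro M _ _ F hF
    have hinj : Function.Injective F.aug := by
      rw [injective_iff_map_eq_zero]
      intro a ha
      obtain ⟨x, rfl⟩ := (F.exact_zero a).1 ha
      have : IsEmpty (Fin (F.rank (0 + 1))) := by rw [hF 1 one_pos]; infer_instance
      rw [Subsingleton.elim x 0, map_zero]
    have : Module.Projective S M :=
      Module.Projective.of_equiv (LinearEquiv.ofBijective F.aug ⟨hinj, F.aug_surjective⟩)
    exact (projective_iff_hasProjectiveDimensionLE_zero _).1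
      ((IsProjective.iff_projective M).1 this)
  | succ N ih =>
    intro M _ _ F hF
    have h₁ := ih F.truncate fun j hj => hF (j + 1) (by omega)
    let T : ShortComplex (ModuleCat S) := ShortComplex.mk
      (ModuleCat.ofHom (LinearMap.ker F.aug).subtype) (ModuleCat.ofHom F.aug) (by ext x; simp)
    have hT : T.ShortExact :=
      { exact := by
          rw [ShortComplex.ShortExact.moduleCat_exact_iff_function_exact]
          exact LinearMap.exact_subtype_ker_map F.aug
        mono_f := (ModuleCat.mono_iff_injective _).2 (Submodule.injective_subtype _)
        epi_g := (ModuleCat.epi_iff_surjective _).2 F.aug_surjective }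
    have h₂ : Projective T.X₂ :=
      (IsProjective.iff_projective (Fin (F.rank 0) → S)).1 inferInstance
    exact (hT.hasProjectiveDimensionLT_X₃_iff N h₂).2 h₁

theorem theorem6p1 {K : Type*} [Field K] (n q r : ℕ) (hq : 1 ≤ q) (hr : 2 ≤ r)
    (m : Fin q → MvPolynomial (Fin n) K) (hm : ∀ i, IsSquarefreeMonomial (m i))
    (I : Ideal (MvPolynomial (Fin n) K)) (hI : IsMinimallyGeneratedBy I m) :
    Nonempty (FreeResolution (MvPolynomial (Fin n) K) ↥(I ^ r)) ∧
    ∃ f : ℕ,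
      (f : ℚ) = (((q + r - 1).choose r : ℚ) - (baseCoeff q r : ℚ) - (q : ℚ)) / (q : ℚ)
        + (baseCoeff q r : ℚ) ∧
      (∀ t : ℕ,
        (bettiNumber (MvPolynomial (Fin n) K) ↥(I ^ r) t : ℤ) ≤
          (q : ℤ) * (((q - 1).choose t : ℤ) + (f.choose (t + 1) : ℤ)
              - ((baseCoeff q r).choose (t + 1) : ℤ))
            + ((baseCoeff q r).choose (t + 1) : ℤ)) ∧
      CategoryTheory.projectiveDimension
          (ModuleCat.of (MvPolynomial (Fin n) K) ↥(I ^ r)) ≤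
        ((max (q - 1) (f - 1) : ℕ) : WithBot ℕ∞) := by
  choose A hA using hm
  set e : Fin q → Fin n →₀ ℕ := fun i => ∑ x ∈ A i, Finsupp.single x 1
  have hme : m = fun i => monomial (e i) 1 := funext fun i => by
    rw [hA i, SimplicialResolution.prod_X_eq_monomial]
  have hJ : ∀ p, p ∈ I ^ r ↔ ∀ u, coeff u p ≠ 0 →
      ∃ a : SimplicialResolution.ExponentVector q r,
        SimplicialResolution.exponentLabel e a ≤ u := by
    rw [← hI.1, hme]
    exact SimplicialResolution.mem_pow_iff_exponentLabel e r
  let o : SimplicialResolution.ExponentVector q r → ℕ := fun a => (Fintype.equivFin _ a : ℕ)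
  have ho : Function.Injective o := Fin.val_injective.comp (Equiv.injective _)
  obtain ⟨F, hF⟩ := SimplicialResolution.exists_freeResolution K o
    (SimplicialResolution.exponentLabel e) SimplicialResolution.isLowerSet_powerComplex ho
    (by simpa [SimplicialResolution.powerComplex] using Fin.pos_iff_nonempty.1 hq)
    (SimplicialResolution.acyclic_degreeSubcomplex_powerComplex hq hr
      (fun i x => SimplicialResolution.sum_single_apply_le_one (A i) x) ho) (I ^ r) hJ
  obtain ⟨f, hf, hfq⟩ := SimplicialResolution.exists_card_sideVertices hq hr
  have hrank := fun t => (hF t).trans_le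
    (SimplicialResolution.card_faces_powerComplex_le hr hf t)
  have hbf : (SimplicialResolution.baseVertices q r).card ≤ f := by
    rw [← hf ⟨0, hq⟩]
    exact Finset.card_le_card (SimplicialResolution.baseVertices_subset_sideVertices hr _)
  rw [← SimplicialResolution.baseCoeff_eq_card] at hfq hbf hrank
  refine ⟨⟨F⟩, f, ?_, fun t => ?_, ?_⟩
  · have hq0 : (q : ℚ) ≠ 0 := by positivity
    have hcast : ((q + r - 1).choose r : ℚ) + ((q : ℚ) - 1) * baseCoeff q r = q * f + q := by
      rw [← Nat.cast_one (R := ℚ), ← Nat.cast_sub hq]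
      exact_mod_cast hfq
    field_simp
    linear_combination -hcast
  · have h : (bettiNumber (MvPolynomial (Fin n) K) ↥(I ^ r) t : ℤ) ≤ _ :=
      Nat.cast_le.2 ((F.bettiNumber_le_rank t).trans (hrank t))
    rw [Nat.cast_add, Nat.cast_add, Nat.cast_mul, Nat.cast_mul,
      Nat.cast_sub (Nat.choose_le_choose _ hbf)] at h
    linarith
  · rw [CategoryTheory.projectiveDimension_le_iff]
    refine F.hasProjectiveDimensionLE _ fun j hj => Nat.le_zero.1 ((hrank j).trans_eq ?_)
    -- Beyond `max (q - 1) (f - 1)` every binomial coefficient in the face bound vanishes, as `b ≤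
    -- f`.
    rw [Nat.choose_eq_zero_of_lt (show baseCoeff q r < j + 1 by omega),
      Nat.choose_eq_zero_of_lt (show f < j + 1 by omega),
      Nat.choose_eq_zero_of_lt (show q - 1 < j by omega)]
    simp
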